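/- Let $\kappa>0$ and $D_\kappa=\pi/\sqrt{\kappa}$. Let $(M,d)$ be a complete $\mathrm{CAT}(\kappa)$ space, that is, a complete metric space in which any two points at distance less than $D_\kappa$ are joined by a geodesic and every geodesic triangle of perimeter less than $2D_\kappa$ satisfies the $\mathrm{CAT}(\kappa)$ comparison inequality with respect to the $2$-sphere of constant curvature $\kappa$. Assume that $\operatorname{diam}(M)<D_\kappa/2$. Let $A,B\subseteq M$ be closed convex sets with $A\cap B\neq\emptyset$, where a set $C$ is convex if any two points of $C$ are joined by a geodesic in $M$ and every such geodesic is contained in $C$. For a non-empty closed convex set $C$ let $P_C\colon M\to C$ be the metric projection, so that $P_C(x)$ is the unique point of $C$ with $d(x,P_C(x))=\inf_{c\in C}d(x,c)$. Let $x_0\in M$ be arbitrary and define $$x_{2n-1}=P_A(x_{2n-2}),\qquad x_{2n}=P_B(x_{2n-1})\qquad(n\ge 1).$$ If $A$ or $B$ is boundedly compact (each of its bounded closed subsets is compact), then the sequence $(x_n)$ converges in the metric $d$ to a point of $A\cap B$. -/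

import Mathlib

namespace CATSpace

/-- `D_κ = π / √κ`, the diameter of the model sphere of curvature `κ > 0`. -/
noncomputable def modelDiam (κ : ℝ) : ℝ := Real.pi / Real.sqrt κ

/-- The unit sphere `𝕊² ⊆ ℝ³`, the underlying set of the model space `M_κ²`. -/
abbrev ModelSphere : Type := Metric.sphere (0 : EuclideanSpace ℝ (Fin 3)) 1

/-- The distance of `M_κ²`: the angular distance `arccos ⟨x, y⟩ ∈ [0, π]` scaled by `1 / √κ`. -/
noncomputable def modelDist (κ : ℝ) (x y : ModelSphere) : ℝ :=
  Real.arccos (inner ℝ (x : EuclideanSpace ℝ (Fin 3)) (y : EuclideanSpace ℝ (Fin 3))) /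
    Real.sqrt κ

/-- `γ : [0, 1] → X` is a geodesic joining `x` and `y` for the distance function `δ`. The distance
is an argument so that the same notion serves a metric space (`δ = dist`) and the model space. -/
def IsGeodesic {X : Type*} (δ : X → X → ℝ) (γ : unitInterval → X) (x y : X) : Prop :=
  γ 0 = x ∧ γ 1 = y ∧ ∀ s t : unitInterval, δ (γ s) (γ t) = δ x y * |(s : ℝ) - (t : ℝ)|

/-- Three vertices `v 0, v 1, v 2`, with `γ i` a geodesic side joining `v i` and `v (i + 1)`
(indices modulo `3`). -/
def IsGeodesicTriangle {X : Type*} (δ : X → X → ℝ) (v : Fin 3 → X)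
    (γ : Fin 3 → unitInterval → X) : Prop :=
  ∀ i, IsGeodesic δ (γ i) (v i) (v (i + 1))

/-- `(w, η)` is a comparison triangle in `M_κ²` for the triangle with vertices `v`. -/
def IsComparisonTriangle {M : Type*} [MetricSpace M] (κ : ℝ) (v : Fin 3 → M)
    (w : Fin 3 → ModelSphere) (η : Fin 3 → unitInterval → ModelSphere) : Prop :=
  IsGeodesicTriangle (modelDist κ) w η ∧
    ∀ i, dist (v i) (v (i + 1)) = modelDist κ (w i) (w (i + 1))

/-- The `CAT(κ)` inequality for a geodesic triangle `(v, γ)`: for every comparison triangle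
`(w, η)`, all points `p`, `q` on the `i`-th and `j`-th sides and all comparison points `p'`, `q'`
on the corresponding sides, `d(p, q) ≤ ρ(p', q')`. -/
def SatisfiesCATInequality {M : Type*} [MetricSpace M] (κ : ℝ) (v : Fin 3 → M)
    (γ : Fin 3 → unitInterval → M) : Prop :=
  ∀ (w : Fin 3 → ModelSphere) (η : Fin 3 → unitInterval → ModelSphere),
    IsComparisonTriangle κ v w η →
    ∀ i j : Fin 3, ∀ p ∈ Set.range (γ i), ∀ q ∈ Set.range (γ j),
    ∀ p' ∈ Set.range (η i), ∀ q' ∈ Set.range (η j),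
      dist p (v i) = modelDist κ p' (w i) → dist q (v j) = modelDist κ q' (w j) →
      dist p q ≤ modelDist κ p' q'

/-- A `CAT(κ)` space (`κ > 0`): points at distance less than `D_κ` are joined by a geodesic, and
every geodesic triangle of perimeter less than `2 D_κ` satisfies the `CAT(κ)` inequality. -/
structure IsCAT (κ : ℝ) (M : Type*) [MetricSpace M] : Prop where
  exists_geodesic : ∀ x y : M, dist x y < modelDiam κ → ∃ γ, IsGeodesic dist γ x y
  cat_inequality : ∀ (v : Fin 3 → M) (γ : Fin 3 → unitInterval → M),
    IsGeodesicTriangle dist v γ → ∑ i, dist (v i) (v (i + 1)) < 2 * modelDiam κ →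
    SatisfiesCATInequality κ v γ

/-- Any two points of `C` are joined by a geodesic in `M`, and every such geodesic stays in `C`. -/
def IsGeodesicallyConvex {M : Type*} [MetricSpace M] (C : Set M) : Prop :=
  ∀ x ∈ C, ∀ y ∈ C, (∃ γ, IsGeodesic dist γ x y) ∧
    ∀ γ, IsGeodesic dist γ x y → Set.range γ ⊆ C

/-- `p` is a point of `C` with `d(x, p) = d(x, C)`. -/
def IsNearestPoint {M : Type*} [MetricSpace M] (C : Set M) (x p : M) : Prop :=
  p ∈ C ∧ dist x p = Metric.infDist x C

open Classical in
/-- The metric projection `P_C`: the unique point of `C` nearest to `x`, with the default value `x`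
where there is no such unique point. -/
noncomputable def metricProj {M : Type*} [MetricSpace M] (C : Set M) (x : M) : M :=
  if h : ∃! p, IsNearestPoint C x p then h.choose else x

/-- The alternating projection sequence started at `x₀`:
`x_{2n+1} = P_A (x_{2n})` and `x_{2n+2} = P_B (x_{2n+1})`. -/
noncomputable def altProj {M : Type*} [MetricSpace M] (A B : Set M) (x₀ : M) : ℕ → M
  | 0 => x₀
  | n + 1 => if Even n then metricProj A (altProj A B x₀ n) else metricProj B (altProj A B x₀ n)

/-- A metric space is boundedly compact if its bounded closed subsets are compact. -/
def BoundedlyCompact (X : Type*) [MetricSpace X] : Prop :=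
  ∀ S : Set X, Bornology.IsBounded S → IsClosed S → IsCompact S

end CATSpace

namespace CATSpace

open Real Filter Topology

/-! Below diameter `D_κ / 2` the function `cos (√κ d)` is positive and decreasing in `d`. Comparison
with a spherical triangle bounds it below along geodesics (`IsCAT.cos_dist_geodesic_ge`). At the
midpoint this gives existence and uniqueness of projections. Differentiated at a projection `p` of
`x` onto `C`, it gives a Pythagorean inequality, `cos (√κ d(x,c)) ≤ cos (√κ d(x,p)) * cos (√κ
d(p,c))` for `c ∈ C` (`IsCAT.cos_dist_le_of_isNearestPoint`).

For `z ∈ A ∩ B` the cosines of the distances to `z` thus increase to a positive limit, so the step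
cosines tend to 1 and the steps to 0. By compactness a subsequence in one set converges. Vanishing
steps put its limit in the other set too, and monotonicity of the distance to that limit extends
convergence to the whole sequence. -/

/-! ### Geodesics and triangles on the model sphere. -/

lemma sqrt_mul_modelDist {κ : ℝ} (hκ : 0 < κ) (u v : ModelSphere) :
    √κ * modelDist κ u v =
      arccos (inner ℝ (u : EuclideanSpace ℝ (Fin 3)) (v : EuclideanSpace ℝ (Fin 3))) := by
  unfold modelDist
  have := sqrt_pos.2 hκ
  field_simp

lemma cos_sqrt_mul_modelDist {κ : ℝ} (hκ : 0 < κ) (u v : ModelSphere) :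
    cos (√κ * modelDist κ u v) =
      inner ℝ (u : EuclideanSpace ℝ (Fin 3)) (v : EuclideanSpace ℝ (Fin 3)) := by
  rw [sqrt_mul_modelDist hκ]
  have hu : ‖(u : EuclideanSpace ℝ (Fin 3))‖ = 1 := norm_eq_of_mem_sphere u
  have hv : ‖(v : EuclideanSpace ℝ (Fin 3))‖ = 1 := norm_eq_of_mem_sphere v
  have h := abs_real_inner_le_norm (u : EuclideanSpace ℝ (Fin 3)) (v : EuclideanSpace ℝ (Fin 3))
  rw [hu, hv, mul_one, abs_le] at h
  exact cos_arccos h.1 h.2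

/-- Non-antipodal points of the model sphere are joined by a geodesic, given by spherical linear
interpolation. -/
lemma exists_model_geodesic (κ : ℝ) (u v : ModelSphere) {θ : ℝ} (hθ0 : 0 ≤ θ)
    (hθ : θ < π)
    (huv : inner ℝ (u : EuclideanSpace ℝ (Fin 3)) (v : EuclideanSpace ℝ (Fin 3)) = cos θ) :
    ∃ η : unitInterval → ModelSphere, IsGeodesic (modelDist κ) η u v ∧
      ∀ t : unitInterval, sin θ • (η t : EuclideanSpace ℝ (Fin 3)) =
        sin ((1 - t) * θ) • (u : EuclideanSpace ℝ (Fin 3)) +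
          sin (t * θ) • (v : EuclideanSpace ℝ (Fin 3)) := by
  have hu : ‖(u : EuclideanSpace ℝ (Fin 3))‖ = 1 := norm_eq_of_mem_sphere u
  have hv : ‖(v : EuclideanSpace ℝ (Fin 3))‖ = 1 := norm_eq_of_mem_sphere v
  have huu : inner ℝ (u : EuclideanSpace ℝ (Fin 3)) (u : EuclideanSpace ℝ (Fin 3)) = 1 := by
    rw [real_inner_self_eq_norm_sq, hu]; norm_num
  have hvv : inner ℝ (v : EuclideanSpace ℝ (Fin 3)) (v : EuclideanSpace ℝ (Fin 3)) = 1 := by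
    rw [real_inner_self_eq_norm_sq, hv]; norm_num
  rcases hθ0.eq_or_lt with rfl | hpos
  · rw [cos_zero] at huv
    have h : u = v := Subtype.ext ((inner_eq_one_iff_of_norm_eq_one hu hv).1 huv)
    subst h
    refine ⟨fun _ => u, ⟨rfl, rfl, fun s t => ?_⟩, fun t => ?_⟩
    · simp [modelDist]
    · simp
  have hs : 0 < sin θ := sin_pos_of_pos_of_lt_pi hpos hθ
  -- The unit tangent vector at `u` pointing towards `v`; the geodesic is the great circle arc `cos
  -- (tθ) u + sin (tθ) e`.
  set e : EuclideanSpace ℝ (Fin 3) := (sin θ)⁻¹ • ((v : EuclideanSpace ℝ (Fin 3)) - cos θ • u.1)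
    with he
  have hve : (v : EuclideanSpace ℝ (Fin 3)) = cos θ • u.1 + sin θ • e := by
    rw [he, smul_smul, mul_inv_cancel₀ hs.ne', one_smul]; abel
  have hue : inner ℝ (u : EuclideanSpace ℝ (Fin 3)) e = 0 := by
    rw [he, real_inner_smul_right, inner_sub_right, real_inner_smul_right, huv, huu]; ring
  have hee : inner ℝ e e = 1 := by
    have h1 : inner ℝ (v : EuclideanSpace ℝ (Fin 3)) (v : EuclideanSpace ℝ (Fin 3)) =
        cos θ ^ 2 + sin θ ^ 2 * inner ℝ e e := by
      conv_lhs => rw [hve]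
      simp only [inner_add_left, inner_add_right, real_inner_smul_left, real_inner_smul_right, huu,
        hue, real_inner_comm u.1 e]
      ring
    rw [hvv] at h1
    have h2 := sin_sq_add_cos_sq θ
    have h3 : sin θ ^ 2 * (inner ℝ e e - 1) = 0 := by linarith
    rcases mul_eq_zero.1 h3 with h | h
    · exact absurd h (by positivity)
    · linarith
  have key : ∀ s t : ℝ, inner ℝ (cos (s * θ) • u.1 + sin (s * θ) • e)
      (cos (t * θ) • u.1 + sin (t * θ) • e) = cos (θ * |s - t|) := by
    intro s t
    have : cos (θ * |s - t|) = cos (s * θ - t * θ) := by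
      rw [← cos_abs (s * θ - t * θ), ← sub_mul, abs_mul, abs_of_pos hpos, mul_comm]
    rw [this, cos_sub]
    simp only [inner_add_left, inner_add_right, real_inner_smul_left, real_inner_smul_right, huu,
      hue, real_inner_comm u.1 e, hee]
    ring
  refine ⟨fun t => ⟨cos (t * θ) • u.1 + sin (t * θ) • e, ?_⟩, ⟨?_, ?_, fun s t => ?_⟩, fun t => ?_⟩
  · rw [mem_sphere_zero_iff_norm]
    have h := key t t
    rw [sub_self, abs_zero, mul_zero, cos_zero, real_inner_self_eq_norm_sq] at h
    nlinarith [norm_nonneg (cos (t * θ) • u.1 + sin (t * θ) • e)]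
  · ext1; simp
  · ext1; simp [hve]
  · have h1 : |(s : ℝ) - t| ≤ 1 := by
      rw [abs_le]; constructor <;> linarith [s.2.1, s.2.2, t.2.1, t.2.2]
    have h2 : θ * |(s : ℝ) - t| ≤ θ := by nlinarith
    unfold modelDist
    rw [key s t, huv, arccos_cos (by positivity) (by linarith), arccos_cos hθ0 hθ.le]
    ring
  · simp only
    rw [hve, show (1 - (t : ℝ)) * θ = θ - t * θ by ring, sin_sub]
    module

/-- Put `u` and `v` on the equator; the spherical law of cosines dictates the second coordinate `s`
of `w`. The triangle inequalities, via the expansions of `cos (a ± b)`, say exactly that `|s| ≤ sin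
b`, leaving room for the third coordinate. -/
lemma exists_model_triangle {a b c : ℝ} (ha0 : 0 < a) (ha : a < π)
    (hab : a + b ≤ π) (h1 : c ≤ a + b) (h2 : |a - b| ≤ c) :
    ∃ u v w : ModelSphere,
      inner ℝ (u : EuclideanSpace ℝ (Fin 3)) (v : EuclideanSpace ℝ (Fin 3)) = cos a ∧
      inner ℝ (u : EuclideanSpace ℝ (Fin 3)) (w : EuclideanSpace ℝ (Fin 3)) = cos b ∧
      inner ℝ (v : EuclideanSpace ℝ (Fin 3)) (w : EuclideanSpace ℝ (Fin 3)) = cos c := by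
  have hs : 0 < sin a := sin_pos_of_pos_of_lt_pi ha0 ha
  have hc0 : 0 ≤ c := (abs_nonneg _).trans h2
  have hub : cos c ≤ cos (a - b) := by
    rw [← cos_abs (a - b)]
    exact cos_le_cos_of_nonneg_of_le_pi (abs_nonneg _) (by linarith) h2
  have hlb : cos (a + b) ≤ cos c := cos_le_cos_of_nonneg_of_le_pi hc0 hab h1
  rw [cos_sub] at hub
  rw [cos_add] at hlb
  set s := (cos c - cos a * cos b) / sin a with hsdef
  have hss : sin a * s = cos c - cos a * cos b := by rw [hsdef]; field_simp
  have hs2 : s ^ 2 ≤ sin b ^ 2 := by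
    apply sq_le_sq'
    · rw [hsdef, le_div_iff₀ hs]; linarith
    · rw [hsdef, div_le_iff₀ hs]; linarith
  have hr := sq_sqrt (sub_nonneg.2 hs2)
  refine ⟨⟨!₂[1, 0, 0], ?_⟩, ⟨!₂[cos a, sin a, 0], ?_⟩,
    ⟨!₂[cos b, s, √(sin b ^ 2 - s ^ 2)], ?_⟩, ?_, ?_, ?_⟩
  · simp [EuclideanSpace.norm_eq, Fin.sum_univ_three]
  · simp [EuclideanSpace.norm_eq, Fin.sum_univ_three]
  · rw [mem_sphere_zero_iff_norm, EuclideanSpace.norm_eq, sqrt_eq_one, Fin.sum_univ_three]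
    simp only [Matrix.cons_val, norm_eq_abs, sq_abs]
    rw [hr]
    linarith [sin_sq_add_cos_sq b]
  · simp [PiLp.inner_apply, Fin.sum_univ_three]
  · simp [PiLp.inner_apply, Fin.sum_univ_three]
  · simp [PiLp.inner_apply, Fin.sum_univ_three]
    linarith

/-! ### Comparison along geodesics. -/

variable {M : Type*} [MetricSpace M] {κ : ℝ}

/-- In a `CAT(κ)` space of diameter less than `D_κ / 2`, the function `cos (√κ d(p, ·))` is bounded
below along a geodesic by its spherical interpolation. -/
lemma IsCAT.cos_dist_geodesic_ge (hκ : 0 < κ) (hM : IsCAT κ M)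
    (hd : ∀ x y : M, √κ * dist x y < π / 2) {x y : M} (p : M) {γ : unitInterval → M}
    (hγ : IsGeodesic dist γ x y) (t : unitInterval) :
    sin ((1 - t) * (√κ * dist x y)) * cos (√κ * dist p x) +
      sin (t * (√κ * dist x y)) * cos (√κ * dist p y) ≤
      sin (√κ * dist x y) * cos (√κ * dist p (γ t)) := by
  have hk : 0 < √κ := sqrt_pos.2 hκ
  rcases eq_or_ne x y with rfl | hxy
  · simp
  set a := √κ * dist x y with ha
  set b := √κ * dist p x with hb
  set c := √κ * dist p y with hc
  have hpi := pi_pos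
  have ha0 : 0 < a := mul_pos hk (dist_pos.2 hxy)
  have hb0 : 0 ≤ b := by positivity
  have hc0 : 0 ≤ c := by positivity
  have ha2 : a < π / 2 := hd x y
  have hb2 : b < π / 2 := hd p x
  have hc2 : c < π / 2 := hd p y
  have hlt : ∀ x y : M, dist x y < modelDiam κ / 2 := fun x y => by
    unfold modelDiam
    rw [div_div, mul_comm, ← div_div, lt_div_iff₀ hk, mul_comm]
    exact hd x y
  have hD : 0 < modelDiam κ := by unfold modelDiam; positivity
  obtain ⟨u, v, w, huv, huw, hvw⟩ := exists_model_triangle (a := a) (b := b) (c := c) ha0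
    (by linarith) (by linarith)
    (by have := mul_le_mul_of_nonneg_left (dist_triangle p x y) hk.le; rw [mul_add] at this
        linarith)
    (by
      rw [abs_le]
      have h1 := mul_le_mul_of_nonneg_left (dist_triangle p y x) hk.le
      have h2 := mul_le_mul_of_nonneg_left (dist_triangle x p y) hk.le
      rw [dist_comm y x, mul_add] at h1
      rw [dist_comm x p, mul_add] at h2
      constructor <;> linarith)
  obtain ⟨η₀, hη₀, hη₀s⟩ := exists_model_geodesic κ u v ha0.le (by linarith) huv
  obtain ⟨η₁, hη₁, -⟩ := exists_model_geodesic κ v w hc0 (by linarith) hvw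
  rw [real_inner_comm] at huw
  obtain ⟨η₂, hη₂, -⟩ := exists_model_geodesic κ w u hb0 (by linarith) huw
  obtain ⟨γ₁, hγ₁⟩ := hM.exists_geodesic y p (by linarith [hlt y p])
  obtain ⟨γ₂, hγ₂⟩ := hM.exists_geodesic p x (by linarith [hlt p x])
  have hdist : ∀ (x y : M) (u v : ModelSphere),
      inner ℝ (u : EuclideanSpace ℝ (Fin 3)) (v : EuclideanSpace ℝ (Fin 3)) =
        cos (√κ * dist x y) → dist x y = modelDist κ u v := by
    intro x y u v h
    have h3 := sqrt_mul_modelDist hκ u v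
    rw [h, arccos_cos (by positivity) (by linarith [hd x y])] at h3
    exact (mul_left_cancel₀ hk.ne' h3).symm
  have hxyuv : dist x y = modelDist κ u v := hdist x y u v huv
  have hcat := hM.cat_inequality ![x, y, p] ![γ, γ₁, γ₂]
    (by intro i; fin_cases i; exacts [hγ, hγ₁, hγ₂])
    (by
      rw [Fin.sum_univ_three]
      change dist x y + dist y p + dist p x < _
      linarith [hlt x y, hlt y p, hlt p x])
    ![u, v, w] ![η₀, η₁, η₂]
    (by
      refine ⟨by intro i; fin_cases i; exacts [hη₀, hη₁, hη₂], ?_⟩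
      intro i; fin_cases i
      · exact hxyuv
      · exact hdist y p v w (by rw [hvw, hc, dist_comm])
      · exact hdist p x w u huw)
    -- The vertex `p` enters as the initial point of side 2, so its distance to the base vertex is
    -- zero on both sides.
    0 2 (γ t) ⟨t, rfl⟩ p ⟨0, hγ₂.1⟩ (η₀ t) ⟨t, rfl⟩ w ⟨0, hη₂.1⟩
    (by
      change dist (γ t) x = modelDist κ (η₀ t) u
      have h1 := hγ.2.2 t 0
      have h2 := hη₀.2.2 t 0
      rw [hγ.1] at h1
      rw [hη₀.1] at h2
      rw [h1, h2, hxyuv])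
    (by
      change dist p p = modelDist κ w w
      have h2 := hη₂.2.2 0 0
      rw [hη₂.1] at h2
      rw [h2]; simp)
  have hcos : cos (√κ * modelDist κ (η₀ t) w) ≤ cos (√κ * dist p (γ t)) := by
    apply cos_le_cos_of_nonneg_of_le_pi (by positivity)
    · rw [sqrt_mul_modelDist hκ]; exact arccos_le_pi _
    · rw [dist_comm]; exact mul_le_mul_of_nonneg_left hcat hk.le
  refine le_trans (le_of_eq ?_) (mul_le_mul_of_nonneg_left hcos
    (sin_nonneg_of_nonneg_of_le_pi ha0.le (by linarith)))
  rw [cos_sqrt_mul_modelDist hκ, ← real_inner_smul_left, hη₀s, inner_add_left,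
    real_inner_smul_left, real_inner_smul_left, hvw, real_inner_comm, huw]

lemma sqrt_mul_dist_lt_pi_div_two (hκ : 0 < κ)
    (hdiam : Metric.ediam (Set.univ : Set M) < ENNReal.ofReal (modelDiam κ / 2)) (x y : M) :
    √κ * dist x y < π / 2 := by
  have hk : 0 < √κ := sqrt_pos.2 hκ
  have h := (Metric.edist_le_ediam_of_mem (Set.mem_univ x) (Set.mem_univ y)).trans_lt hdiam
  rw [edist_dist, ENNReal.ofReal_lt_ofReal_iff_of_nonneg dist_nonneg] at h
  unfold modelDiam at h
  rwa [div_div, mul_comm, ← div_div, lt_div_iff₀ hk, mul_comm] at h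

lemma cos_sqrt_mul_dist_pos (hd : ∀ x y : M, √κ * dist x y < π / 2) (x y : M) :
    0 < cos (√κ * dist x y) :=
  cos_pos_of_mem_Ioo ⟨by have : 0 ≤ √κ * dist x y := by positivity
                         linarith [pi_pos], hd x y⟩

/-! ### Projections onto convex sets. -/

lemma cos_sqrt_mul_dist_le_infDist (hd : ∀ x y : M, √κ * dist x y < π / 2) {C : Set M} (x : M)
    {y : M} (hy : y ∈ C) : cos (√κ * dist x y) ≤ cos (√κ * Metric.infDist x C) := by
  apply cos_le_cos_of_nonneg_of_le_pi (mul_nonneg (sqrt_nonneg _) Metric.infDist_nonneg)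
    (by linarith [hd x y, pi_pos])
  gcongr
  exact Metric.infDist_le_dist_of_mem hy

/-- The midpoint of `y` and `z` stays in `C`, hence is no closer to `x` than `C` is. This plays the
role of uniform convexity. -/
lemma IsCAT.cos_dist_add_cos_dist_le (hκ : 0 < κ) (hM : IsCAT κ M)
    (hd : ∀ x y : M, √κ * dist x y < π / 2) {C : Set M} (hC : IsGeodesicallyConvex C) (x : M)
    {y z : M} (hy : y ∈ C) (hz : z ∈ C) :
    cos (√κ * dist x y) + cos (√κ * dist x z) ≤
      2 * cos (√κ * dist y z / 2) * cos (√κ * Metric.infDist x C) := by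
  have hk : 0 < √κ := sqrt_pos.2 hκ
  rcases eq_or_ne y z with rfl | hyz
  · simp only [dist_self, mul_zero, zero_div, cos_zero]
    linarith [cos_sqrt_mul_dist_le_infDist hd x hy]
  obtain ⟨⟨γ, hγ⟩, hγC⟩ := hC y hy z hz
  let t : unitInterval := ⟨1 / 2, by norm_num, by norm_num⟩
  have h := hM.cos_dist_geodesic_ge hκ hd x hγ t
  have hm := cos_sqrt_mul_dist_le_infDist hd x (hγC γ hγ ⟨t, rfl⟩)
  set a := √κ * dist y z with ha
  have ha0 : 0 < a := mul_pos hk (dist_pos.2 hyz)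
  have ha2 : a < π / 2 := hd y z
  have hs : 0 < sin (a / 2) := sin_pos_of_pos_of_lt_pi (by linarith) (by linarith)
  have hc : 0 < cos (a / 2) := cos_pos_of_mem_Ioo ⟨by linarith, by linarith⟩
  have e1 : (1 - (t : ℝ)) * a = a / 2 := by change (1 - 1 / 2 : ℝ) * a = _; ring
  have e2 : (t : ℝ) * a = a / 2 := by change (1 / 2 : ℝ) * a = _; ring
  have e3 : sin a = 2 * sin (a / 2) * cos (a / 2) := by
    rw [← sin_two_mul]; congr 1; ring
  rw [e1, e2, e3] at h
  have h' : sin (a / 2) * (cos (√κ * dist x y) + cos (√κ * dist x z)) ≤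
      sin (a / 2) * (2 * cos (a / 2) * cos (√κ * dist x (γ t))) := by linarith
  refine (le_of_mul_le_mul_left h' hs).trans ?_
  gcongr

/-- Near-minimizers that are `ε` apart would violate the midpoint bound, so minimizing sequences are
Cauchy; the same bound separates two minimizers. -/
lemma IsCAT.existsUnique_isNearestPoint [CompleteSpace M] (hκ : 0 < κ) (hM : IsCAT κ M)
    (hd : ∀ x y : M, √κ * dist x y < π / 2) {C : Set M} (hCc : IsClosed C)
    (hC : IsGeodesicallyConvex C) (hne : C.Nonempty) (x : M) : ∃! p, IsNearestPoint C x p := by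
  have hk : 0 < √κ := sqrt_pos.2 hκ
  set S := cos (√κ * Metric.infDist x C) with hS
  have hS0 : 0 < S := by
    obtain ⟨c, hc⟩ := hne
    exact (cos_sqrt_mul_dist_pos hd x c).trans_le (cos_sqrt_mul_dist_le_infDist hd x hc)
  have hclose : ∀ ε > 0, ∀ y ∈ C, ∀ z ∈ C, ε ≤ dist y z →
      cos (√κ * ε / 2) < 1 ∧
        cos (√κ * dist x y) + cos (√κ * dist x z) ≤ 2 * cos (√κ * ε / 2) * S := by
    intro ε hε y hy z hz hyz
    have h1 : √κ * ε ≤ √κ * dist y z := by gcongr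
    have h2 := hd y z
    have h3 : 0 < √κ * ε := by positivity
    constructor
    · rw [← cos_zero]
      exact cos_lt_cos_of_nonneg_of_le_pi le_rfl (by linarith [pi_pos]) (by linarith)
    · refine (hM.cos_dist_add_cos_dist_le hκ hd hC x hy hz).trans ?_
      gcongr 2 * ?_ * S
      exact cos_le_cos_of_nonneg_of_le_pi (by linarith) (by linarith [pi_pos]) (by linarith)
  have hseq : ∀ n : ℕ, ∃ c ∈ C, dist x c < Metric.infDist x C + 1 / ((n : ℝ) + 1) := fun n =>
    (Metric.infDist_lt_iff hne).1 (lt_add_of_pos_right _ (by positivity))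
  choose c hcC hc using hseq
  have hlim : Tendsto (fun n => dist x (c n)) atTop (𝓝 (Metric.infDist x C)) := by
    refine tendsto_of_tendsto_of_tendsto_of_le_of_le tendsto_const_nhds ?_
      (fun n => Metric.infDist_le_dist_of_mem (hcC n)) (fun n => (hc n).le)
    simpa using tendsto_one_div_add_atTop_nhds_zero_nat.const_add (Metric.infDist x C)
  have hcos : Tendsto (fun n => cos (√κ * dist x (c n))) atTop (𝓝 S) :=
    (continuous_cos.tendsto _).comp (hlim.const_mul _)
  have hcauchy : CauchySeq c := by
    rw [Metric.cauchySeq_iff]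
    intro ε hε
    -- For large `ε` the cosine may return to 1; then no two points of `C` are that far apart.
    by_cases hcε : cos (√κ * ε / 2) < 1
    · obtain ⟨N, hN⟩ := eventually_atTop.1
        (hcos.eventually_const_lt (show cos (√κ * ε / 2) * S < S by nlinarith))
      refine ⟨N, fun m hm n hn => ?_⟩
      by_contra! h
      linarith [(hclose ε hε _ (hcC m) _ (hcC n) h).2, hN m hm, hN n hn]
    · refine ⟨0, fun m _ n _ => ?_⟩
      by_contra! h
      exact hcε (hclose ε hε _ (hcC m) _ (hcC n) h).1
  obtain ⟨p, hp⟩ := cauchySeq_tendsto_of_complete hcauchy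
  have hpC : p ∈ C := hCc.mem_of_tendsto hp (Eventually.of_forall hcC)
  have hpd : dist x p = Metric.infDist x C :=
    tendsto_nhds_unique (tendsto_const_nhds.dist hp) hlim
  refine ⟨p, ⟨hpC, hpd⟩, ?_⟩
  rintro q ⟨hqC, hq⟩
  by_contra hqp
  have h := hclose (dist q p) (dist_pos.2 hqp) q hqC p hpC le_rfl
  rw [hq, hpd] at h
  nlinarith [h.1, h.2]

lemma isNearestPoint_metricProj {C : Set M} {x : M} (h : ∃! p, IsNearestPoint C x p) :
    IsNearestPoint C x (metricProj C x) := by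
  rw [metricProj, dif_pos h]
  exact h.choose_spec.1

/-- The triangle formed by a point, its projection onto a convex set and a point of that set is at
least as obtuse as a right-angled spherical triangle. -/
lemma IsCAT.cos_dist_le_of_isNearestPoint (hκ : 0 < κ) (hM : IsCAT κ M)
    (hd : ∀ x y : M, √κ * dist x y < π / 2) {C : Set M} (hC : IsGeodesicallyConvex C) {x p c : M}
    (hp : IsNearestPoint C x p) (hc : c ∈ C) :
    cos (√κ * dist x c) ≤ cos (√κ * dist x p) * cos (√κ * dist p c) := by
  have hk : 0 < √κ := sqrt_pos.2 hκ
  rcases eq_or_ne p c with rfl | hpc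
  · simp
  obtain ⟨⟨γ, hγ⟩, hγC⟩ := hC p hp.1 c hc
  set a := √κ * dist p c with ha
  have ha0 : 0 < a := mul_pos hk (dist_pos.2 hpc)
  have ha2 : a < π / 2 := hd p c
  have hs : 0 ≤ sin a := sin_nonneg_of_nonneg_of_le_pi ha0.le (by linarith [pi_pos])
  -- Divided by `t`, both sides become difference quotients at 0, with limits `a` and `a cos a`.
  have hstep : ∀ t : ℝ, 0 < t → t ≤ 1 →
      cos (√κ * dist x c) * (t⁻¹ * sin (t * a)) ≤
        cos (√κ * dist x p) * (t⁻¹ * (sin a - sin ((1 - t) * a))) := by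
    intro t ht0 ht1
    have h := hM.cos_dist_geodesic_ge hκ hd x hγ ⟨t, ht0.le, ht1⟩
    have hm := cos_sqrt_mul_dist_le_infDist hd x (hγC γ hγ ⟨⟨t, ht0.le, ht1⟩, rfl⟩)
    rw [← hp.2] at hm
    have h1 := h.trans (mul_le_mul_of_nonneg_left hm hs)
    have h2 : cos (√κ * dist x c) * sin (t * a) ≤
        cos (√κ * dist x p) * (sin a - sin ((1 - t) * a)) := by
      simp only at h1
      linarith
    have h3 := mul_le_mul_of_nonneg_left h2 (inv_nonneg.2 ht0.le)
    linarith
  have hl : HasDerivAt (fun t : ℝ => sin (t * a)) a 0 := by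
    have := ((hasDerivAt_id (0 : ℝ)).mul_const a).sin
    simpa using this
  have hr : HasDerivAt (fun t : ℝ => - sin ((1 - t) * a)) (cos a * a) 0 := by
    have := (((hasDerivAt_id (0 : ℝ)).const_sub 1).mul_const a).sin.neg
    simp only [id_eq, sub_zero, one_mul, neg_mul, mul_neg, neg_neg] at this
    exact this
  have hl' := hl.tendsto_slope_zero_right
  have hr' := hr.tendsto_slope_zero_right
  simp only [zero_add, zero_mul, sin_zero, sub_zero, one_mul, smul_eq_mul] at hl' hr'
  have hfin := le_of_tendsto_of_tendsto (hl'.const_mul (cos (√κ * dist x c)))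
    (hr'.const_mul (cos (√κ * dist x p))) (by
      filter_upwards [Ioc_mem_nhdsGT (zero_lt_one' ℝ)] with t ht
      refine (hstep t ht.1 ht.2).trans (le_of_eq ?_)
      ring)
  exact le_of_mul_le_mul_right (hfin.trans_eq (mul_assoc _ _ _).symm) ha0

/-! ### Convergence of the alternating sequence. -/

lemma dist_le_of_cos_le (hκ : 0 < κ) (hd : ∀ x y : M, √κ * dist x y < π / 2) {x y z : M}
    (h : cos (√κ * dist x z) ≤ cos (√κ * dist y z)) : dist y z ≤ dist x z := by
  have hk : 0 < √κ := sqrt_pos.2 hκ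
  by_contra! hlt
  have := cos_lt_cos_of_nonneg_of_le_pi (x := √κ * dist x z) (y := √κ * dist y z) (by positivity)
    (by linarith [hd y z, pi_pos]) (by gcongr)
  linarith

lemma tendsto_dist_zero_of_tendsto_cos (hκ : 0 < κ) (hd : ∀ x y : M, √κ * dist x y < π / 2)
    {u v : ℕ → M} (h : Tendsto (fun n => cos (√κ * dist (u n) (v n))) atTop (𝓝 1)) :
    Tendsto (fun n => dist (u n) (v n)) atTop (𝓝 0) := by
  have hk : 0 < √κ := sqrt_pos.2 hκ
  have h1 := ((continuous_arccos.tendsto 1).comp h).const_mul (√κ)⁻¹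
  rw [arccos_one, mul_zero] at h1
  refine h1.congr fun n => ?_
  simp only [Function.comp_apply]
  rw [inv_mul_eq_iff_eq_mul₀ hk.ne']
  exact arccos_cos (by positivity) (by linarith [hd (u n) (v n), pi_pos])

/-- If all triangles formed by consecutive terms of a sequence and a fixed point have an at least
right spherical angle at the later term, then the consecutive distances tend to zero. -/
lemma tendsto_dist_succ_zero (hκ : 0 < κ) (hd : ∀ x y : M, √κ * dist x y < π / 2)
    {u : ℕ → M} {z : M}
    (h : ∀ n, cos (√κ * dist (u n) z) ≤
      cos (√κ * dist (u n) (u (n + 1))) * cos (√κ * dist (u (n + 1)) z)) :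
    Tendsto (fun n => dist (u n) (u (n + 1))) atTop (𝓝 0) := by
  have hpos : ∀ n, 0 < cos (√κ * dist (u n) z) := fun n => cos_sqrt_mul_dist_pos hd _ _
  have hmono : Monotone fun n => cos (√κ * dist (u n) z) := monotone_nat_of_le_succ fun n =>
    (h n).trans (mul_le_of_le_one_left (hpos _).le (cos_le_one _))
  have hlim := tendsto_atTop_ciSup hmono ⟨1, by rintro _ ⟨n, rfl⟩; exact cos_le_one _⟩
  set L := ⨆ n, cos (√κ * dist (u n) z)
  -- A nonzero limit makes the ratio of consecutive terms tend to 1, and this ratio bounds the step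
  -- cosine from below.
  have hL : L ≠ 0 := ((hpos 0).trans_le (hmono.ge_of_tendsto hlim 0)).ne'
  have hquot := hlim.div (hlim.comp (tendsto_add_atTop_nat 1)) hL
  rw [div_self hL] at hquot
  exact tendsto_dist_zero_of_tendsto_cos hκ hd <|
    tendsto_of_tendsto_of_tendsto_of_le_of_le hquot tendsto_const_nhds
      (fun n => (div_le_iff₀ (hpos (n + 1))).2 (h n)) (fun n => cos_le_one _)

lemma tendsto_of_antitone_dist {u : ℕ → M} {z : M} (hu : Antitone fun n => dist (u n) z)
    {φ : ℕ → ℕ} (hφ : Tendsto φ atTop atTop) (h : Tendsto (u ∘ φ) atTop (𝓝 z)) :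
    Tendsto u atTop (𝓝 z) := by
  rw [tendsto_iff_dist_tendsto_zero]
  exact (tendsto_iff_tendsto_subseq_of_antitone hu hφ).2 (tendsto_iff_dist_tendsto_zero.1 h)

lemma BoundedlyCompact.isCompact {C : Set M} (h : BoundedlyCompact C)
    (hC : Bornology.IsBounded C) : IsCompact C := by
  have h1 := h Set.univ (Bornology.isBounded_induced.2 (hC.subset (by simp))) isClosed_univ
  exact isCompact_iff_isCompact_univ.2 h1

/-- A sequence approaching closed sets `A` and `B` alternately, Fejér monotone with respect to
`A ∩ B` and with steps tending to zero, converges if one of the sets is compact. -/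
lemma exists_tendsto_of_alternating {A B K : Set M} (hA : IsClosed A) (hB : IsClosed B)
    (hK : IsCompact K) {u : ℕ → M} (huA : ∀ n, u (2 * n + 1) ∈ A) (huB : ∀ n, u (2 * n + 2) ∈ B)
    (hfejer : ∀ z ∈ A ∩ B, Antitone fun n => dist (u n) z)
    (hstep : Tendsto (fun n => dist (u n) (u (n + 1))) atTop (𝓝 0))
    (hcpt : (∀ n, u (2 * n + 1) ∈ K) ∨ ∀ n, u (2 * n + 2) ∈ K) :
    ∃ x ∈ A ∩ B, Tendsto u atTop (𝓝 x) := by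
  have hodd : Tendsto (fun n : ℕ => 2 * n + 1) atTop atTop :=
    tendsto_atTop_mono (fun n => by simp only [id]; omega) tendsto_id
  have hstep' : Tendsto (fun n => dist (u (2 * n + 1)) (u (2 * n + 2))) atTop (𝓝 0) :=
    hstep.comp hodd
  obtain ⟨z, φ, hφ, h1, h2⟩ : ∃ (z : M) (φ : ℕ → ℕ), StrictMono φ ∧
      Tendsto (fun n => u (2 * φ n + 1)) atTop (𝓝 z) ∧
      Tendsto (fun n => u (2 * φ n + 2)) atTop (𝓝 z) := by
    rcases hcpt with h | h
    · obtain ⟨z, -, φ, hφ, hz⟩ := hK.tendsto_subseq h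
      exact ⟨z, φ, hφ, hz, (tendsto_iff_of_dist (hstep'.comp hφ.tendsto_atTop)).1 hz⟩
    · obtain ⟨z, -, φ, hφ, hz⟩ := hK.tendsto_subseq h
      exact ⟨z, φ, hφ, (tendsto_iff_of_dist (hstep'.comp hφ.tendsto_atTop)).2 hz, hz⟩
  have hz : z ∈ A ∩ B := ⟨hA.mem_of_tendsto h1 (Eventually.of_forall fun n => huA _),
    hB.mem_of_tendsto h2 (Eventually.of_forall fun n => huB _)⟩
  exact ⟨z, hz, tendsto_of_antitone_dist (hfejer z hz) (hodd.comp hφ.tendsto_atTop) h1⟩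

end CATSpace

theorem corollary3p8 {M : Type*} [MetricSpace M] [CompleteSpace M] (κ : ℝ) (hκ : 0 < κ)
    (hM : CATSpace.IsCAT κ M)
    (hdiam : Metric.ediam (Set.univ : Set M) < ENNReal.ofReal (CATSpace.modelDiam κ / 2))
    (A B : Set M) (hAclosed : IsClosed A) (hBclosed : IsClosed B)
    (hAconvex : CATSpace.IsGeodesicallyConvex A) (hBconvex : CATSpace.IsGeodesicallyConvex B)
    (hAB : (A ∩ B).Nonempty)
    (hcompact : CATSpace.BoundedlyCompact A ∨ CATSpace.BoundedlyCompact B) (x₀ : M) :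
    ∃ x ∈ A ∩ B, Filter.Tendsto (CATSpace.altProj A B x₀) Filter.atTop (nhds x) := by
  have hd := CATSpace.sqrt_mul_dist_lt_pi_div_two hκ hdiam
  -- Since the whole space is bounded, a boundedly compact set is compact.
  have hbdd (s : Set M) : Bornology.IsBounded s :=
    (Metric.isBounded_iff_ediam_ne_top.2 (hdiam.trans ENNReal.ofReal_lt_top).ne).subset
      (Set.subset_univ s)
  have hA (x : M) : CATSpace.IsNearestPoint A x (CATSpace.metricProj A x) :=
    CATSpace.isNearestPoint_metricProj
      (hM.existsUnique_isNearestPoint hκ hd hAclosed hAconvex hAB.left x)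
  have hB (x : M) : CATSpace.IsNearestPoint B x (CATSpace.metricProj B x) :=
    CATSpace.isNearestPoint_metricProj
      (hM.existsUnique_isNearestPoint hκ hd hBclosed hBconvex hAB.right x)
  set u := CATSpace.altProj A B x₀ with hu
  have hsucc (n : ℕ) : u (n + 1) =
      if Even n then CATSpace.metricProj A (u n) else CATSpace.metricProj B (u n) := by
    rw [hu, CATSpace.altProj]
  have hright : ∀ z ∈ A ∩ B, ∀ n, Real.cos (√κ * dist (u n) z) ≤
      Real.cos (√κ * dist (u n) (u (n + 1))) * Real.cos (√κ * dist (u (n + 1)) z) := by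
    intro z hz n
    rw [hsucc]
    split_ifs
    · exact hM.cos_dist_le_of_isNearestPoint hκ hd hAconvex (hA _) hz.1
    · exact hM.cos_dist_le_of_isNearestPoint hκ hd hBconvex (hB _) hz.2
  have hfejer : ∀ z ∈ A ∩ B, Antitone fun n => dist (u n) z := fun z hz =>
    antitone_nat_of_succ_le fun n => CATSpace.dist_le_of_cos_le hκ hd <| (hright z hz n).trans <|
      mul_le_of_le_one_left (CATSpace.cos_sqrt_mul_dist_pos hd _ _).le (Real.cos_le_one _)
  -- The start `x₀` may lie in neither set, so membership begins at indices 1 and 2.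
  have huA (n : ℕ) : u (2 * n + 1) ∈ A := by
    rw [hsucc, if_pos (even_two_mul n)]
    exact (hA _).1
  have huB (n : ℕ) : u (2 * n + 2) ∈ B := by
    rw [hsucc, if_neg (by simp)]
    exact (hB _).1
  obtain ⟨z, hz⟩ := hAB
  have hstep := CATSpace.tendsto_dist_succ_zero hκ hd (hright z hz)
  rcases hcompact with h | h
  · exact CATSpace.exists_tendsto_of_alternating hAclosed hBclosed (h.isCompact (hbdd A)) huA huB
      hfejer hstep (Or.inl huA)
  · exact CATSpace.exists_tendsto_of_alternating hAclosed hBclosed (h.isCompact (hbdd B)) huA huB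
      hfejer hstep (Or.inr huB)
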